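/- For an integer $n\ge 5$, let $\mathrm{NB}_n$ be the necklace braid group, i.e. the group generated by $\sigma_1,\dots,\sigma_n,\tau$ subject to the relations, with indices taken modulo $n$, $$\sigma_i\sigma_{i+1}\sigma_i=\sigma_{i+1}\sigma_i\sigma_{i+1},\qquad \sigma_i\sigma_j=\sigma_j\sigma_i\ \text{ for } i-j\not\equiv\pm1 \pmod n,\qquad \tau\sigma_i\tau^{-1}=\sigma_{i+1},\qquad \tau^{2n}=1.$$ Let $\mathcal B_n$ be Artin's braid group on $n$ strands, with standard generators $\sigma_1,\dots,\sigma_{n-1}$. A representation $\rho$ of $\mathrm{NB}_n$ restricts to a representation $\rho|_{\mathcal B_n}$ of $\mathcal B_n$ along the homomorphism $\mathcal B_n\to\mathrm{NB}_n$, $\sigma_i\mapsto\sigma_i$ $(1\le i\le n-1)$, whose image is the subgroup of $\mathrm{NB}_n$ generated by $\sigma_1,\dots,\sigma_{n-1}$. **Theorem.** Let $n\ge5$ and let $(\rho,V)$ be an irreducible complex representation of $\mathrm{NB}_n$ with $\dim_{\mathbb C}V=n-1$. If $\rho|_{\mathcal B_n}$ is completely reducible, then $\rho|_{\mathcal B_n}$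 is irreducible. -/

import Mathlib

/-! ### The necklace braid group -/

/-- Generators of the necklace braid group: `σ i` for `i` an integer modulo `n`
(so `σ n = σ 0`), and `τ`. -/
inductive NecklaceGen (n : ℕ) : Type
  | sigma (i : ZMod n) : NecklaceGen n
  | tau : NecklaceGen n

/-- The defining relators of the necklace braid group, with indices modulo `n`. -/
inductive NecklaceRel (n : ℕ) : FreeGroup (NecklaceGen n) → Prop
  /-- `σ i * σ (i+1) * σ i = σ (i+1) * σ i * σ (i+1)` -/
  | braid (i : ZMod n) : NecklaceRel n
      ((FreeGroup.of (.sigma i) * FreeGroup.of (.sigma (i + 1)) * FreeGroup.of (.sigma i)) *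
        (FreeGroup.of (.sigma (i + 1)) * FreeGroup.of (.sigma i) *
          FreeGroup.of (.sigma (i + 1)))⁻¹)
  /-- `σ i * σ j = σ j * σ i` if `i` and `j` are not cyclically adjacent -/
  | comm (i j : ZMod n) (h₁ : i - j ≠ 1) (h₂ : i - j ≠ -1) : NecklaceRel n
      ((FreeGroup.of (.sigma i) * FreeGroup.of (.sigma j)) *
        (FreeGroup.of (.sigma j) * FreeGroup.of (.sigma i))⁻¹)
  /-- `τ * σ i * τ⁻¹ = σ (i+1)` -/
  | conj (i : ZMod n) : NecklaceRel n
      ((FreeGroup.of .tau * FreeGroup.of (.sigma i) * (FreeGroup.of .tau)⁻¹) *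
        (FreeGroup.of (.sigma (i + 1)))⁻¹)
  /-- `τ ^ (2n) = 1` -/
  | torsion : NecklaceRel n (FreeGroup.of .tau ^ (2 * n))

/-- The necklace braid group `NB_n`. -/
abbrev NecklaceBraidGroup (n : ℕ) : Type :=
  PresentedGroup {r : FreeGroup (NecklaceGen n) | NecklaceRel n r}

/-- The generator `σ i` of `NB_n`, `i` taken modulo `n`. -/
def NecklaceBraidGroup.sigma {n : ℕ} (i : ZMod n) : NecklaceBraidGroup n :=
  PresentedGroup.of (.sigma i)

/-- The generator `τ` of `NB_n`. -/
def NecklaceBraidGroup.tau {n : ℕ} : NecklaceBraidGroup n :=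
  PresentedGroup.of .tau

/-! ### Artin's braid group -/

/-- The defining relators of Artin's braid group on `n` strands. The index `i : Fin (n - 1)`
stands for the generator usually written with the subscript `i + 1`, so the generators are
`σ 1, …, σ (n - 1)`. -/
inductive ArtinBraidRel (n : ℕ) : FreeGroup (Fin (n - 1)) → Prop
  /-- `σ i * σ (i+1) * σ i = σ (i+1) * σ i * σ (i+1)` -/
  | braid (i j : Fin (n - 1)) (h : (i : ℕ) + 1 = j) : ArtinBraidRel n
      ((FreeGroup.of i * FreeGroup.of j * FreeGroup.of i) *
        (FreeGroup.of j * FreeGroup.of i * FreeGroup.of j)⁻¹)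
  /-- `σ i * σ j = σ j * σ i` if `i + 2 ≤ j` -/
  | comm (i j : Fin (n - 1)) (h : (i : ℕ) + 2 ≤ j) : ArtinBraidRel n
      ((FreeGroup.of i * FreeGroup.of j) * (FreeGroup.of j * FreeGroup.of i)⁻¹)

/-- Artin's braid group `B_n` on `n` strands. -/
abbrev ArtinBraidGroup (n : ℕ) : Type :=
  PresentedGroup {r : FreeGroup (Fin (n - 1)) | ArtinBraidRel n r}

namespace NecklaceBraidGroup

theorem sigma_braid {n : ℕ} (i : ZMod n) :
    sigma i * sigma (i + 1) * sigma i = sigma (i + 1) * sigma i * sigma (i + 1) := by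
  have h := PresentedGroup.one_of_mem (rels := {r | NecklaceRel n r}) (NecklaceRel.braid i)
  rw [map_mul, map_inv, mul_inv_eq_one] at h
  simp only [map_mul] at h
  exact h

theorem sigma_comm {n : ℕ} (i j : ZMod n) (h₁ : i - j ≠ 1) (h₂ : i - j ≠ -1) :
    sigma i * sigma j = sigma j * sigma i := by
  have h := PresentedGroup.one_of_mem (rels := {r | NecklaceRel n r})
    (NecklaceRel.comm i j h₁ h₂)
  rw [map_mul, map_inv, mul_inv_eq_one] at h
  simp only [map_mul] at h
  exact h

end NecklaceBraidGroup

theorem ArtinBraidRel.lift_eq_one (n : ℕ) (r : FreeGroup (Fin (n - 1)))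
    (hr : ArtinBraidRel n r) :
    FreeGroup.lift (fun i : Fin (n - 1) =>
      NecklaceBraidGroup.sigma (((i : ℕ) + 1 : ℕ) : ZMod n)) r = 1 := by
  cases hr with
  | braid i j h =>
    simp only [map_mul, map_inv, FreeGroup.lift_apply_of, ← h]
    rw [mul_inv_eq_one]
    simpa using NecklaceBraidGroup.sigma_braid (((i : ℕ) + 1 : ℕ) : ZMod n)
  | comm i j h =>
    simp only [map_mul, map_inv, FreeGroup.lift_apply_of]
    rw [mul_inv_eq_one]
    have hi := i.isLt
    have hj := j.isLt
    apply NecklaceBraidGroup.sigma_comm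
    · intro e
      have e' : (((i : ℕ) + 1 : ℕ) : ZMod n) = (((j : ℕ) + 2 : ℕ) : ZMod n) := by
        push_cast at e ⊢
        linear_combination e
      rw [ZMod.natCast_eq_natCast_iff] at e'
      have hd := (Nat.modEq_iff_dvd' (by omega)).1 e'
      have := Nat.le_of_dvd (by omega) hd
      omega
    · intro e
      have e' : (((i : ℕ) + 2 : ℕ) : ZMod n) = (((j : ℕ) + 1 : ℕ) : ZMod n) := by
        push_cast at e ⊢
        linear_combination e
      rw [ZMod.natCast_eq_natCast_iff] at e'
      have hd := (Nat.modEq_iff_dvd' (by omega)).1 e'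
      have := Nat.le_of_dvd (by omega) hd
      omega

/-- The homomorphism `B_n → NB_n` sending `σ i` to `σ i` for `1 ≤ i ≤ n - 1`. -/
def ArtinBraidGroup.toNecklace (n : ℕ) : ArtinBraidGroup n →* NecklaceBraidGroup n :=
  PresentedGroup.toGroup (rels := {r | ArtinBraidRel n r}) (ArtinBraidRel.lift_eq_one n)

/-- The restriction to `B_n` of a representation of `NB_n`. -/
def restrictToBraid {k V : Type*} [CommSemiring k] [AddCommMonoid V] [Module k V] {n : ℕ}
    (ρ : Representation k (NecklaceBraidGroup n) V) :
    Representation k (ArtinBraidGroup n) V :=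
  MonoidHom.comp ρ (ArtinBraidGroup.toNecklace n)

/-- The image of `B_n` in `NB_n` is the subgroup generated by `σ 1, …, σ (n - 1)`. -/
theorem ArtinBraidGroup.range_toNecklace (n : ℕ) :
    (ArtinBraidGroup.toNecklace n).range =
      Subgroup.closure (Set.range fun i : Fin (n - 1) =>
        NecklaceBraidGroup.sigma (((i : ℕ) + 1 : ℕ) : ZMod n)) := by
  rw [MonoidHom.range_eq_map, ← PresentedGroup.closure_range_of, MonoidHom.map_closure,
    ← Set.range_comp]
  congr 2

/-!
The restriction of `ρ` to `B_n` is irreducible for two reasons that pull in opposite directions.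

A small representation of `B_n` is close to trivial: if `n ≥ 5` and the dimension is at most
`(n - 1) / 2`, all standard generators act by the same endomorphism
(`IsBraidFamily.eq_zero_of_two_mul_finrank_le`), so they have a common eigenvector. The induction
behind this restricts to an eigenspace of the first generator, where the generators commuting with
it form a braid group on two strands fewer.

On the other hand, `B_n` has no common eigenvector in `V`. If `v` were one, then each `τ ^ k v`
would be an eigenvector of all `σ j` with `j ≠ k`, for the same eigenvalue. As `V` is irreducible,
no nonzero vector is a common eigenvector of all the `σ j`, and it follows that the `n` vectors
`v, τ v, …, τ ^ (n - 1) v` are linearly independent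
(`NecklaceBraidGroup.le_finrank_of_common_eigenvector`), which is impossible in dimension `n - 1`.

So every nonzero `B_n`-stable subspace has dimension greater than `(n - 1) / 2`, and `V` is not the
direct sum of two of them.
-/

/-! ### Braid relations in small dimension -/

section BraidFamily

variable {K W : Type*} [Field K] [AddCommGroup W] [Module K W]

/-- `s 0, …, s (k - 1)` are invertible endomorphisms satisfying the relations of the standard
generators of Artin's braid group on `k + 1` strands. The values `s i` with `k ≤ i` are
irrelevant. -/
structure IsBraidFamily (k : ℕ) (s : ℕ → Module.End K W) : Prop where
  isUnit : ∀ i < k, IsUnit (s i)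
  braid : ∀ i, i + 1 < k → s i * s (i + 1) * s i = s (i + 1) * s i * s (i + 1)
  comm : ∀ i j, i + 2 ≤ j → j < k → Commute (s i) (s j)

theorem IsUnit.eq_of_commute_of_braid {M : Type*} [Monoid M] {a b : M} (ha : IsUnit a)
    (hb : IsUnit b) (h : a * b * a = b * a * b) (hab : Commute a b) : a = b := by
  rw [← hab.eq, mul_assoc, mul_assoc, ← hab.eq] at h
  exact hb.mul_left_cancel (ha.mul_left_cancel (by rw [← hab.eq, h]))

namespace IsBraidFamily

variable {k : ℕ} {s : ℕ → Module.End K W}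

theorem shift (h : IsBraidFamily k s) (m : ℕ) : IsBraidFamily (k - m) fun i => s (i + m) where
  isUnit i hi := h.isUnit _ (by omega)
  braid i hi := by
    have := h.braid (i + m) (by omega)
    rwa [add_right_comm] at this
  comm i j hij hj := h.comm _ _ (by omega) (by omega)

theorem eq_succ_of_commute (h : IsBraidFamily k s) {i : ℕ} (hi : i + 1 < k)
    (hc : Commute (s i) (s (i + 1))) : s i = s (i + 1) :=
  (h.isUnit i (by omega)).eq_of_commute_of_braid (h.isUnit _ hi) (h.braid i hi) hc

/-- If two neighbours `s i`, `s (i + 1)` agree then so do the next two, since `s (i + 2)` commutes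
with `s i`; likewise in the other direction. -/
theorem eq_succ_iff (h : IsBraidFamily k s) {i : ℕ} (hi : i + 2 < k) :
    s i = s (i + 1) ↔ s (i + 1) = s (i + 2) := by
  have hc := h.comm i (i + 2) le_rfl hi
  refine ⟨fun e => ?_, fun e => ?_⟩
  · rw [e] at hc
    exact h.eq_succ_of_commute hi hc
  · rw [← e] at hc
    exact h.eq_succ_of_commute (by omega) hc

theorem eq_zero_of_commute (h : IsBraidFamily k s) {i : ℕ} (hi : i + 1 < k)
    (hc : Commute (s i) (s (i + 1))) : ∀ j < k, s j = s 0 := by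
  have key : ∀ j, j + 1 < k → (s j = s (j + 1) ↔ s 0 = s 1) := by
    intro j
    induction j with
    | zero => simp
    | succ j ih => exact fun hj => (h.eq_succ_iff hj).symm.trans (ih (by omega))
  have h0 := (key i hi).1 (h.eq_succ_of_commute hi hc)
  intro j
  induction j with
  | zero => simp
  | succ j ih => exact fun hj => ((key j hj).2 h0).symm.trans (ih (by omega))

theorem restrict [FiniteDimensional K W] (h : IsBraidFamily k s) (U : Submodule K W)
    (hU : ∀ i, ∀ x ∈ U, s i x ∈ U) : IsBraidFamily k fun i => (s i).restrict (hU i) where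
  isUnit i hi := by
    have := (Module.End.isUnit_iff _).1 (h.isUnit i hi)
    rw [LinearMap.isUnit_iff_ker_eq_bot, LinearMap.ker_eq_bot]
    intro x y hxy
    exact Subtype.ext (this.1 (congrArg Subtype.val hxy))
  braid i hi := by
    ext x
    exact LinearMap.congr_fun (h.braid i hi) x
  comm i j hij hj := by
    ext x
    exact LinearMap.congr_fun (h.comm i j hij hj).eq x

theorem mapQ [FiniteDimensional K W] (h : IsBraidFamily k s) (U : Submodule K W)
    (hU : ∀ i, U ≤ U.comap (s i)) : IsBraidFamily k fun i => U.mapQ U (s i) (hU i) where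
  isUnit i hi := by
    have := (Module.End.isUnit_iff _).1 (h.isUnit i hi)
    rw [LinearMap.isUnit_iff_range_eq_top, LinearMap.range_eq_top]
    intro x
    obtain ⟨x, rfl⟩ := U.mkQ_surjective x
    obtain ⟨y, rfl⟩ := this.2 x
    exact ⟨U.mkQ y, rfl⟩
  braid i hi := by
    ext x
    exact congrArg U.mkQ (LinearMap.congr_fun (h.braid i hi) x)
  comm i j hij hj := by
    ext x
    exact congrArg U.mkQ (LinearMap.congr_fun (h.comm i j hij hj).eq x)

/-- If the generators agree on `U` and modulo `U`, then `(s 2 - s 0) * (s 3 - s 0)` and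
`(s 3 - s 0) * (s 2 - s 0)` vanish; as `s 0` commutes with `s 2` and `s 3`, this forces `s 2` and
`s 3` to commute. -/
theorem eq_zero_of_extension (h : IsBraidFamily k s) (hk : 4 ≤ k) (U : Submodule K W)
    (hsub : ∀ i < k, ∀ x ∈ U, s i x = s 0 x) (hquot : ∀ i < k, ∀ x, s i x - s 0 x ∈ U) :
    ∀ i < k, s i = s 0 := by
  have hz : ∀ i < k, ∀ j < k, (s i - s 0) * (s j - s 0) = 0 := by
    intro i hi j hj
    ext x
    simpa [sub_eq_zero] using hsub i hi _ (hquot j hj x)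
  have h2 := (h.comm 0 2 (by omega) (by omega)).eq
  have h3 := (h.comm 0 3 (by omega) (by omega)).eq
  have e : (s 2 - s 0) * (s 3 - s 0) = (s 3 - s 0) * (s 2 - s 0) := by
    rw [hz 2 (by omega) 3 (by omega), hz 3 (by omega) 2 (by omega)]
  simp only [sub_mul, mul_sub, h2, h3] at e
  refine h.eq_zero_of_commute (i := 2) (by omega) (?_ : s 2 * s 3 = s 3 * s 2)
  rw [← sub_eq_zero] at e ⊢
  rw [← e]
  abel

end IsBraidFamily

theorem Module.End.exists_linearIndependent_of_not_scalar {f : Module.End K W}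
    (hf : ∀ c : K, f ≠ algebraMap K _ c) : ∃ v, LinearIndependent K ![v, f v] := by
  by_contra! H
  obtain ⟨a, ha⟩ := LinearMap.exists_eq_smul_id_of_forall_notLinearIndependent H
  exact hf a (by rw [ha]; rfl)

/-- The centralizer of a non-scalar endomorphism `f` of a plane is commutative: if `v`, `f v` is a
basis, then `g` in the centralizer is determined by `g v = a • v + b • f v`, so `g = a + b f`. -/
theorem Module.End.commute_of_commute_of_not_scalar (hW : Module.finrank K W = 2)
    {f g g' : Module.End K W} (hf : ∀ c : K, f ≠ algebraMap K _ c) (hg : Commute f g)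
    (hg' : Commute f g') : Commute g g' := by
  have : FiniteDimensional K W := .of_finrank_pos (by omega)
  obtain ⟨v, hv⟩ := exists_linearIndependent_of_not_scalar hf
  have hspan : ⊤ ≤ Submodule.span K (Set.range ![v, f v]) :=
    (hv.span_eq_top_of_card_eq_finrank' (by simp [hW])).ge
  have hpoly : ∀ g : Module.End K W, Commute f g →
      ∃ a b : K, g = algebraMap K _ a + b • f := by
    intro g hg
    have hm : g v ∈ Submodule.span K (Set.range ![v, f v]) := hspan trivial
    rw [Matrix.range_cons_cons_empty, Submodule.mem_span_pair] at hm
    obtain ⟨a, b, hab⟩ := hm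
    have hgf : g (f v) = f (g v) := (LinearMap.congr_fun hg.eq v).symm
    refine ⟨a, b, (Module.Basis.mk hv hspan).ext fun i => ?_⟩
    fin_cases i
    · simp [← hab, Module.algebraMap_end_apply]
    · simp [← hab, hgf, Module.algebraMap_end_apply]
  obtain ⟨a, b, rfl⟩ := hpoly g hg
  exact (Algebra.commute_algebraMap_left a g').add_left (hg'.smul_left b)

/-- In dimension at most half the number `k ≥ 4` of generators, the generators of the braid group
on `k + 1` strands all act by the same endomorphism. If `s 0` is not scalar, an eigenspace `E` of
it is stable under `s 2, …, s (k - 1)`, which by induction are equal on `E` and modulo `E`, hence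
equal. In dimension two there may be too few generators left, and the commutativity of the
centralizer of `s 0` is used instead. -/
theorem IsBraidFamily.eq_zero_of_two_mul_finrank_le [IsAlgClosed K] [FiniteDimensional K W]
    {k : ℕ} {s : ℕ → Module.End K W} (h : IsBraidFamily k s) (hk : 4 ≤ k)
    (hd : 2 * Module.finrank K W ≤ k) : ∀ i < k, s i = s 0 := by
  induction hN : Module.finrank K W using Nat.strong_induction_on generalizing W k s with
  | _ d ih =>
  by_cases hs : ∃ c : K, s 0 = algebraMap K _ c
  · obtain ⟨c, hc⟩ := hs
    exact h.eq_zero_of_commute (i := 0) (by omega)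
      (hc ▸ Algebra.commute_algebraMap_left c _)
  push Not at hs
  obtain ⟨v, hv⟩ := Module.End.exists_linearIndependent_of_not_scalar hs
  have h2 : 2 ≤ Module.finrank K W := by simpa using hv.fintype_card_le_finrank
  obtain h2 | h3 := h2.eq_or_lt
  · exact h.eq_zero_of_commute (i := 2) (by omega)
      (Module.End.commute_of_commute_of_not_scalar h2.symm hs (h.comm 0 2 (by omega) (by omega))
        (h.comm 0 3 (by omega) (by omega)))
  have : Nontrivial W := Module.nontrivial_of_finrank_pos (R := K) (by omega)
  obtain ⟨c, hc⟩ := Module.End.exists_eigenvalue (s 0)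
  set E := (s 0).eigenspace c with hE
  have hbot : E ≠ ⊥ := hc
  have htop : E ≠ ⊤ := by
    intro e
    refine hs c (LinearMap.ext fun x => ?_)
    have hx : x ∈ E := e ▸ trivial
    simpa [Module.algebraMap_end_apply] using Module.End.mem_eigenspace_iff.1 hx
  -- Nothing makes `E` stable under the unconstrained `s i` with `k ≤ i`; these are replaced by `1`.
  let t : ℕ → Module.End K W := fun i => if i < k - 2 then s (i + 2) else 1
  have hteq : ∀ i < k - 2, t i = s (i + 2) := fun i hi => if_pos hi
  have ht : IsBraidFamily (k - 2) t := by
    have h' := h.shift 2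
    refine ⟨fun i hi => ?_, fun i hi => ?_, fun i j hij hj => ?_⟩
    · rw [hteq i hi]; exact h'.isUnit i hi
    · rw [hteq i (by omega), hteq _ hi]; exact h'.braid i hi
    · rw [hteq i (by omega), hteq j hj]; exact h'.comm i j hij hj
  have htE : ∀ i, ∀ x ∈ E, t i x ∈ E := by
    intro i x hx
    by_cases hi : i < k - 2
    · rw [Module.End.mem_eigenspace_iff] at hx ⊢
      have e := LinearMap.congr_fun (h.comm 0 (i + 2) (by omega) (by omega)).eq x
      simp only [Module.End.mul_apply, hx, map_smul] at e
      rw [hteq i hi, e]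
    · simpa [t, hi] using hx
  have hadd := E.finrank_quotient_add_finrank
  have hpos : 0 < Module.finrank K E := Module.finrank_pos_iff.2 (E.nontrivial_iff_ne_bot.2 hbot)
  have hlt := Submodule.finrank_lt htop
  -- `E` and `W ⧸ E` have dimension at most `d - 1`, and `d ≥ 3` gives `k - 2 ≥ 4`.
  have hsub := ih _ (by omega) (ht.restrict E htE) (by omega) (by omega) rfl
  have hquot := ih _ (by omega) (ht.mapQ E htE) (by omega) (by omega) rfl
  have hall := ht.eq_zero_of_extension (by omega) E
    (fun i hi x hx => congrArg Subtype.val (LinearMap.congr_fun (hsub i hi) ⟨x, hx⟩))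
    (fun i hi x => (Submodule.Quotient.eq E).1 (LinearMap.congr_fun (hquot i hi) (E.mkQ x)))
  refine h.eq_zero_of_commute (i := 2) (by omega) ?_
  rw [← hteq 0 (by omega), ← hteq 1 (by omega), hall 1 (by omega)]

end BraidFamily

/-! ### Irreducible representations of the necklace braid group -/

namespace Representation

variable {K G V : Type*} [Field K] [Group G] [AddCommGroup V] [Module K V] [FiniteDimensional K V]
  (ρ : Representation K G V)

theorem map_eq_of_closure_eq_top {S : Set G} (hS : Subgroup.closure S = ⊤) (U : Submodule K V)
    (hU : ∀ g ∈ S, ∀ v ∈ U, ρ g v ∈ U) (g : G) : U.map (ρ g) = U := by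
  have hg : g ∈ Subgroup.closure S := hS ▸ Subgroup.mem_top g
  induction hg using Subgroup.closure_induction with
  | mem x hx =>
    refine Submodule.eq_of_le_of_finrank_eq (Submodule.map_le_iff_le_comap.2 (hU x hx)) ?_
    exact (U.equivMapOfInjective (ρ x) (ρ.apply_bijective x).1).finrank_eq.symm
  | one => rw [map_one]; exact Submodule.map_id U
  | mul x y _ _ hx hy => rw [map_mul, Module.End.mul_eq_comp, Submodule.map_comp, hy, hx]
  | inv x _ hx =>
    conv_lhs => rw [← hx, ← Submodule.map_comp, ← Module.End.mul_eq_comp, ← map_mul,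
      inv_mul_cancel, map_one]
    exact Submodule.map_id U

/-- For a finite-dimensional irreducible representation of a group, stability under a generating
set (with no condition on inverses) already makes a subspace trivial. -/
theorem IsIrreducible.eq_bot_or_eq_top_of_closure_eq_top (hρ : ρ.IsIrreducible) {S : Set G}
    (hS : Subgroup.closure S = ⊤) (U : Submodule K V) (hU : ∀ g ∈ S, ∀ v ∈ U, ρ g v ∈ U) :
    U = ⊥ ∨ U = ⊤ := by
  let U' : Subrepresentation ρ := ⟨U, fun g v hv =>
    (ρ.map_eq_of_closure_eq_top hS U hU g).le (Submodule.mem_map_of_mem hv)⟩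
  exact (hρ.eq_bot_or_eq_top U').imp (congrArg Subrepresentation.toSubmodule)
    (congrArg Subrepresentation.toSubmodule)

end Representation

namespace NecklaceBraidGroup

variable {n : ℕ}

theorem tau_mul_sigma (i : ZMod n) : tau * sigma i = sigma (i + 1) * tau := by
  have h := PresentedGroup.one_of_mem (rels := {r | NecklaceRel n r}) (NecklaceRel.conj i)
  rw [map_mul, map_inv, mul_inv_eq_one] at h
  simp only [map_mul, map_inv] at h
  exact mul_inv_eq_iff_eq_mul.1 h

theorem tau_pow_mul_sigma (k : ℕ) (i : ZMod n) :
    tau ^ k * sigma i = sigma (i + (k : ZMod n)) * tau ^ k := by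
  induction k generalizing i with
  | zero => simp
  | succ k ih =>
    rw [pow_succ, mul_assoc, tau_mul_sigma, ← mul_assoc, ih, mul_assoc]
    congr 2
    push_cast
    ring

theorem closure_eq_top : Subgroup.closure (insert tau (Set.range sigma)) =
    (⊤ : Subgroup (NecklaceBraidGroup n)) := by
  rw [eq_top_iff, ← PresentedGroup.closure_range_of, Subgroup.closure_le]
  rintro _ ⟨_ | _, rfl⟩
  · exact Subgroup.subset_closure (.inr ⟨_, rfl⟩)
  · exact Subgroup.subset_closure (.inl rfl)

variable {K V : Type*} [Field K] [AddCommGroup V] [Module K V] [FiniteDimensional K V]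
  {ρ : Representation K (NecklaceBraidGroup n) V}

/-- A stable subspace for all the `σ i` and for `τ` is trivial, if `ρ` is irreducible. -/
theorem eq_bot_or_eq_top_of_stable (hρ : ρ.IsIrreducible) (U : Submodule K V)
    (hτ : ∀ v ∈ U, ρ tau v ∈ U) (hσ : ∀ i, ∀ v ∈ U, ρ (sigma i) v ∈ U) : U = ⊥ ∨ U = ⊤ := by
  refine hρ.eq_bot_or_eq_top_of_closure_eq_top ρ closure_eq_top U ?_
  rintro _ (rfl | ⟨i, rfl⟩)
  exacts [hτ, hσ i]

/-- In an irreducible representation of dimension at least two, the `σ i` have no common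
eigenvector: the common eigenspace would be everything, and then `τ`, having an eigenvector, would
leave a line stable. -/
theorem iInf_eigenspace_sigma_eq_bot [IsAlgClosed K] (hρ : ρ.IsIrreducible)
    (hdim : 1 < Module.finrank K V) (c : K) :
    ⨅ i, Module.End.eigenspace (ρ (sigma i)) c = ⊥ := by
  have hmem : ∀ v, v ∈ (⨅ i, Module.End.eigenspace (ρ (sigma i)) c) ↔
      ∀ i, ρ (sigma i) v = c • v := by
    simp [Submodule.mem_iInf]
  refine (eq_bot_or_eq_top_of_stable hρ _ (fun v hv => ?_) fun i v hv => ?_).resolve_right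
    fun htop => ?_
  · rw [hmem] at hv ⊢
    intro i
    have e := tau_mul_sigma (i - 1)
    rw [sub_add_cancel] at e
    rw [← Module.End.mul_apply, ← map_mul, ← e, map_mul, Module.End.mul_apply, hv, map_smul]
  · rw [(hmem v).1 hv i]
    exact Submodule.smul_mem _ _ hv
  · have hσ : ∀ i v, ρ (sigma i) v = c • v := fun i v => (hmem v).1 (htop ▸ trivial) i
    have : Nontrivial V := Module.nontrivial_of_finrank_pos (R := K) (by omega)
    obtain ⟨a, ha⟩ := Module.End.exists_eigenvalue (ρ tau)
    obtain ⟨w, hw⟩ := ha.exists_hasEigenvector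
    have hline := eq_bot_or_eq_top_of_stable hρ (K ∙ w) (fun v hv => ?_) fun i v hv => ?_
    · rw [Submodule.span_singleton_eq_bot] at hline
      have := finrank_span_singleton (K := K) hw.2
      rw [hline.resolve_left hw.2, finrank_top] at this
      omega
    · obtain ⟨b, rfl⟩ := Submodule.mem_span_singleton.1 hv
      rw [map_smul, hw.apply_eq_smul]
      exact Submodule.smul_mem _ _ (Submodule.smul_mem _ _ (Submodule.mem_span_singleton_self w))
    · rw [hσ]
      exact Submodule.smul_mem _ _ hv

/-- A common eigenvector `v` of `σ 1, …, σ (n - 1)` forces dimension at least `n`. Indeed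
`τ ^ k v` is an eigenvector of every `σ j` with `j ≠ k`, so that `σ j - c` turns a linear relation
between the `τ ^ k v` into a multiple of `(σ j - c) (τ ^ j v)`, which does not vanish. -/
theorem le_finrank_of_common_eigenvector [IsAlgClosed K] [NeZero n] (hρ : ρ.IsIrreducible)
    (hdim : 1 < Module.finrank K V) {c : K} {v : V} (hv : v ≠ 0)
    (hc : ∀ i : ZMod n, i ≠ 0 → ρ (sigma i) v = c • v) : n ≤ Module.finrank K V := by
  let w : ZMod n → V := fun k => ρ (tau ^ k.val) v
  have hw : ∀ j k, j ≠ k → ρ (sigma j) (w k) = c • w k := by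
    intro j k hjk
    have e := tau_pow_mul_sigma k.val (j - k)
    rw [ZMod.natCast_zmod_val, sub_add_cancel] at e
    rw [← Module.End.mul_apply, ← map_mul, ← e, map_mul, Module.End.mul_apply,
      hc _ (sub_ne_zero.2 hjk), map_smul]
  have hw' : ∀ j, ρ (sigma j) (w j) - c • w j ≠ 0 := by
    intro j h0
    have hmem : w j ∈ ⨅ i, Module.End.eigenspace (ρ (sigma i)) c := by
      simp only [Submodule.mem_iInf, Module.End.mem_eigenspace_iff]
      intro i
      by_cases hij : i = j
      · rw [hij, sub_eq_zero.1 h0]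
      · exact hw i j hij
    rw [iInf_eigenspace_sigma_eq_bot hρ hdim, Submodule.mem_bot] at hmem
    exact hv ((ρ.apply_bijective _).1 (hmem.trans (map_zero _).symm))
  have hli : LinearIndependent K w := by
    rw [Fintype.linearIndependent_iff]
    intro g hg j
    have e := congrArg (fun x => ρ (sigma j) x - c • x) hg
    simp only [map_sum, map_smul, Finset.smul_sum, ← Finset.sum_sub_distrib, map_zero, smul_zero,
      sub_zero] at e
    rw [Finset.sum_eq_single j (fun k _ hk => ?_) (by simp)] at e
    · rw [smul_comm c, ← smul_sub] at e
      exact (smul_eq_zero.1 e).resolve_right (hw' j)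
    · rw [hw j k hk.symm, smul_comm c, sub_self]
  simpa [ZMod.card] using hli.fintype_card_le_finrank

end NecklaceBraidGroup

namespace ArtinBraidGroup

theorem toNecklace_of {n : ℕ} (i : Fin (n - 1)) :
    toNecklace n (PresentedGroup.of i) = NecklaceBraidGroup.sigma (((i : ℕ) + 1 : ℕ) : ZMod n) :=
  PresentedGroup.toGroup.of (ArtinBraidRel.lift_eq_one n)

theorem of_braid {n : ℕ} (i j : Fin (n - 1)) (h : (i : ℕ) + 1 = j) :
    (PresentedGroup.of i * PresentedGroup.of j * PresentedGroup.of i : ArtinBraidGroup n) =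
      PresentedGroup.of j * PresentedGroup.of i * PresentedGroup.of j := by
  have h := PresentedGroup.one_of_mem (rels := {r | ArtinBraidRel n r}) (ArtinBraidRel.braid i j h)
  rw [map_mul, map_inv, mul_inv_eq_one] at h
  simp only [map_mul] at h
  exact h

theorem of_comm {n : ℕ} (i j : Fin (n - 1)) (h : (i : ℕ) + 2 ≤ j) :
    (PresentedGroup.of i * PresentedGroup.of j : ArtinBraidGroup n) =
      PresentedGroup.of j * PresentedGroup.of i := by
  have h := PresentedGroup.one_of_mem (rels := {r | ArtinBraidRel n r}) (ArtinBraidRel.comm i j h)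
  rw [map_mul, map_inv, mul_inv_eq_one] at h
  simp only [map_mul] at h
  exact h

/-- In a nonzero representation of `B_n`, `n ≥ 5`, of dimension at most `(n - 1) / 2`, the standard
generators have a common eigenvector, with a common eigenvalue. -/
theorem exists_common_eigenvector {K W : Type*} [Field K] [IsAlgClosed K] [AddCommGroup W]
    [Module K W] [FiniteDimensional K W] [Nontrivial W] {n : ℕ} (hn : 5 ≤ n)
    (ρ : Representation K (ArtinBraidGroup n) W) (hd : 2 * Module.finrank K W ≤ n - 1) :
    ∃ (c : K) (v : W), v ≠ 0 ∧ ∀ i, ρ (PresentedGroup.of i) v = c • v := by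
  let s : ℕ → Module.End K W := fun i =>
    if h : i < n - 1 then ρ (PresentedGroup.of ⟨i, h⟩) else 1
  have hs : ∀ i (h : i < n - 1), s i = ρ (PresentedGroup.of ⟨i, h⟩) := fun i h => dif_pos h
  have hfam : IsBraidFamily (n - 1) s := by
    refine ⟨fun i hi => ?_, fun i hi => ?_, fun i j hij hj => ?_⟩
    · rw [hs i hi]
      exact (Group.isUnit _).map ρ
    · rw [hs i (by omega), hs _ hi]
      simpa only [map_mul] using congrArg ρ (of_braid ⟨i, by omega⟩ ⟨i + 1, hi⟩ rfl)
    · rw [hs i (by omega), hs j hj]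
      exact Commute.map (f := ρ) (of_comm ⟨i, by omega⟩ ⟨j, hj⟩ hij)
  obtain ⟨c, hc⟩ := Module.End.exists_eigenvalue (s 0)
  obtain ⟨v, hv⟩ := hc.exists_hasEigenvector
  refine ⟨c, v, hv.2, fun i => ?_⟩
  rw [← hs i i.2, hfam.eq_zero_of_two_mul_finrank_le (by omega) hd i i.2]
  exact hv.apply_eq_smul

end ArtinBraidGroup

/-- A nonzero subrepresentation of `B_n` in an irreducible representation of `NB_n` of dimension
`n - 1` has dimension greater than `(n - 1) / 2`. -/
theorem lt_two_mul_finrank_of_ne_bot {K V : Type*} [Field K] [IsAlgClosed K] [AddCommGroup V]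
    [Module K V] {n : ℕ} (hn : 5 ≤ n) {ρ : Representation K (NecklaceBraidGroup n) V}
    (hρ : ρ.IsIrreducible) (hdim : Module.finrank K V = n - 1)
    (U : Subrepresentation (restrictToBraid ρ)) (hU : U.toSubmodule ≠ ⊥) :
    n - 1 < 2 * Module.finrank K U.toSubmodule := by
  by_contra! hd
  have : FiniteDimensional K V := .of_finrank_pos (by omega)
  have : NeZero n := ⟨by omega⟩
  have : Nontrivial U.toSubmodule := Submodule.nontrivial_iff_ne_bot.2 hU
  obtain ⟨c, v, hv, hc⟩ := ArtinBraidGroup.exists_common_eigenvector hn U.toRepresentation hd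
  have hle := NecklaceBraidGroup.le_finrank_of_common_eigenvector (c := c) (v := (v : V)) hρ
    (by omega) (by simpa using hv) fun i hi => ?_
  · omega
  · have hpos : 0 < i.val := Nat.pos_of_ne_zero fun h => hi ((ZMod.val_eq_zero i).1 h)
    have hlt := i.val_lt
    have e := congrArg Subtype.val (hc ⟨i.val - 1, by omega⟩)
    change ρ (ArtinBraidGroup.toNecklace n _) v = c • (v : V) at e
    rwa [ArtinBraidGroup.toNecklace_of, Nat.sub_add_cancel hpos, ZMod.natCast_zmod_val] at e

theorem mainTheorem6 (n : ℕ) (hn : 5 ≤ n) {V : Type*} [AddCommGroup V] [Module ℂ V]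
    (ρ : Representation ℂ (NecklaceBraidGroup n) V)
    (hρ : ρ.IsIrreducible)
    (hdim : Module.finrank ℂ V = n - 1)
    (hss : (restrictToBraid ρ).IsSemisimpleRepresentation) :
    (restrictToBraid ρ).IsIrreducible := by
  have : FiniteDimensional ℂ V := .of_finrank_pos (by omega)
  have : Nontrivial V := Module.nontrivial_of_finrank_pos (R := ℂ) (by omega)
  have hbt : (⊥ : Subrepresentation (restrictToBraid ρ)) ≠ ⊤ := fun h =>
    bot_ne_top (α := Submodule ℂ V) (congrArg Subrepresentation.toSubmodule h)
  refine { exists_pair_ne := ⟨⊥, ⊤, hbt⟩, eq_bot_or_eq_top := fun U => ?_ }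
  by_contra! hU
  obtain ⟨U', hcompl⟩ := hss.exists_isCompl U
  have hinf : U.toSubmodule ⊓ U'.toSubmodule = ⊥ :=
    congrArg Subrepresentation.toSubmodule hcompl.inf_eq_bot
  have hsup : U.toSubmodule ⊔ U'.toSubmodule = ⊤ :=
    congrArg Subrepresentation.toSubmodule hcompl.sup_eq_top
  have hsum := Submodule.finrank_sup_add_finrank_inf_eq U.toSubmodule U'.toSubmodule
  rw [hinf, hsup, finrank_top, finrank_bot] at hsum
  have h1 := lt_two_mul_finrank_of_ne_bot hn hρ hdim U
    fun h => hU.1 (Subrepresentation.toSubmodule_injective h)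
  have h2 := lt_two_mul_finrank_of_ne_bot hn hρ hdim U' fun h => hU.2 <| by
    rw [h, sup_bot_eq] at hsup
    exact Subrepresentation.toSubmodule_injective hsup
  omega
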